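/- Let $\alpha=(\alpha_n)_{n\ge 0}$ be a bounded sequence of positive real numbers, and let $W_\alpha$ be the weighted shift on the complex Hilbert space $\ell^2=\ell^2(\{0,1,2,\dots\})$, i.e. the bounded operator with $W_\alpha e_j=\alpha_j e_{j+1}$ for all $j\ge 0$, where $(e_j)_{j\ge0}$ is the standard basis. Assume that $W_\alpha$ is a contraction, $\|W_\alpha\|\le 1$. A bounded operator on a complex Hilbert space is subnormal if it is unitarily equivalent to the restriction of a normal operator to a closed invariant subspace. The shift $W_\alpha$ is moment infinitely divisible (MID) if, for every real $t>0$, the weighted shift with weights $(\alpha_n^t)_{n\ge 0}$ is subnormal. For a real sequence $\psi=(\psi(n))_{n\ge 0}$ put $(\nabla\psi)(n)=\psi(n)-\psi(n+1)$ and $\nabla^{k}\psi=\nabla\nabla^{k-1}\psi$, with $\nabla^0\psi=\psi$; $\psi$ is completely alternating if $(\nabla^k\psi)(n)\le 0$ for all $k\ge 1$ and $n\ge 0$. A sequence of positive numbers is log completely alternating if the sequence of its logarithms is completely alternating. Then $W_\alpha$ is moment infinitely divisible if and only if $(\alpha_n^2)$ is log completely alternating, that is, $(\ln\alpha_n^2)$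 is completely alternating. Moreover, $(\alpha_n^2)$ is log completely alternating if and only if $(\alpha_n)$ is log completely alternating. -/

import Mathlib

open scoped ENNReal

universe u

/-- The complex Hilbert space `ℓ²` of square-summable sequences indexed by `0, 1, 2, …`. -/
abbrev EllTwo : Type := lp (fun _ : ℕ => ℂ) 2

/-- The sequence `(0, α₀ x₀, α₁ x₁, …)`. -/
noncomputable def shiftSeq (α : ℕ → ℝ) (x : ℕ → ℂ) : ℕ → ℂ
  | 0 => 0
  | n + 1 => (α n : ℂ) * x n

theorem shiftSeq_bound {α : ℕ → ℝ} {C : ℝ} (hC : ∀ n, |α n| ≤ C) (x : EllTwo) :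
    Summable (fun n => ‖shiftSeq α x n‖ ^ (2 : ℝ)) ∧
      ∑' n, ‖shiftSeq α x n‖ ^ (2 : ℝ) ≤ (C * ‖x‖) ^ (2 : ℝ) := by
  have hC0 : 0 ≤ C := (abs_nonneg _).trans (hC 0)
  have hx : Summable fun n => ‖x n‖ ^ (2 : ℝ) := by
    simpa using (lp.memℓp x).summable (by simp)
  have hn : ‖x‖ ^ (2 : ℝ) = ∑' n, ‖x n‖ ^ (2 : ℝ) := by
    simpa using lp.norm_rpow_eq_tsum (p := 2) (by simp) x
  have hle : ∀ n, ‖shiftSeq α x (n + 1)‖ ^ (2 : ℝ) ≤ C ^ (2 : ℝ) * ‖x n‖ ^ (2 : ℝ) := by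
    intro n
    rw [← Real.mul_rpow hC0 (norm_nonneg _)]
    refine Real.rpow_le_rpow (norm_nonneg _) ?_ (by norm_num)
    simp only [shiftSeq, norm_mul, Complex.norm_real, Real.norm_eq_abs]
    exact mul_le_mul_of_nonneg_right (hC n) (norm_nonneg _)
  have hs1 : Summable fun n => ‖shiftSeq α x (n + 1)‖ ^ (2 : ℝ) :=
    Summable.of_nonneg_of_le (fun n => by positivity) hle (hx.mul_left _)
  have hs : Summable (fun n => ‖shiftSeq α x n‖ ^ (2 : ℝ)) :=
    (summable_nat_add_iff (f := fun n => ‖shiftSeq α x n‖ ^ (2 : ℝ)) 1).1 hs1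
  refine ⟨hs, ?_⟩
  rw [hs.tsum_eq_zero_add, Real.mul_rpow hC0 (norm_nonneg _), hn, ← tsum_mul_left]
  have h0 : ‖shiftSeq α x 0‖ ^ (2 : ℝ) = 0 := by simp [shiftSeq]
  rw [h0, zero_add]
  exact hs1.tsum_le_tsum hle (hx.mul_left _)

theorem shiftSeq_mem {α : ℕ → ℝ} (hα : BddAbove (Set.range fun n => |α n|)) (x : EllTwo) :
    Memℓp (shiftSeq α x) 2 := by
  obtain ⟨C, hC⟩ := hα
  refine memℓp_gen ?_
  simpa using (shiftSeq_bound (fun n => hC ⟨n, rfl⟩) x).1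

/-- The unilateral weighted shift `W_α` on `ℓ²` with bounded weight sequence `α`: the bounded
operator `(x₀, x₁, …) ↦ (0, α₀ x₀, α₁ x₁, …)`, that is, `W_α e_j = α_j e_{j+1}`. -/
noncomputable def weightedShift (α : ℕ → ℝ) (hα : BddAbove (Set.range fun n => |α n|)) :
    EllTwo →L[ℂ] EllTwo :=
  LinearMap.mkContinuousOfExistsBound
    { toFun := fun x => ⟨shiftSeq α x, shiftSeq_mem hα x⟩
      map_add' := fun x y => by
        ext n
        change shiftSeq α (x + y : EllTwo) n = shiftSeq α x n + shiftSeq α y n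
        cases n with
        | zero => simp [shiftSeq]
        | succ n => simp [shiftSeq, mul_add]
      map_smul' := fun c x => by
        ext n
        change shiftSeq α (c • x : EllTwo) n = c * shiftSeq α x n
        cases n with
        | zero => simp [shiftSeq]
        | succ n => simp [shiftSeq, mul_left_comm] }
    (by
      obtain ⟨C, hC⟩ := hα
      have hC' : ∀ n, |α n| ≤ C := fun n => hC ⟨n, rfl⟩
      have hC0 : 0 ≤ C := (abs_nonneg _).trans (hC' 0)
      refine ⟨C, fun x => lp.norm_le_of_tsum_le (by simp) (by positivity) ?_⟩
      simpa using (shiftSeq_bound hC' x).2)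

theorem weightedShift_apply (α : ℕ → ℝ) (hα : BddAbove (Set.range fun n => |α n|))
    (x : EllTwo) (n : ℕ) : weightedShift α hα x n = shiftSeq α x n := rfl

/-- The defining property of the weighted shift on the standard basis. -/
theorem weightedShift_single (α : ℕ → ℝ) (hα : BddAbove (Set.range fun n => |α n|)) (j : ℕ) :
    weightedShift α hα (lp.single 2 j (1 : ℂ)) = (α j : ℂ) • lp.single 2 (j + 1) (1 : ℂ) := by
  ext n
  rw [weightedShift_apply, lp.coeFn_smul]
  change _ = (α j : ℂ) * lp.single (E := fun _ : ℕ => ℂ) 2 (j + 1) (1 : ℂ) n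
  rw [lp.single_apply]
  cases n with
  | zero => simp [shiftSeq]
  | succ n =>
    by_cases h : n = j
    · subst h; simp [shiftSeq]
    · simp [shiftSeq, h]

/-- A bounded operator `T` on a complex Hilbert space `H` is subnormal if it is unitarily
equivalent to the restriction of a normal operator `N` on a Hilbert space `K` to a closed
invariant subspace. The subspace is the (automatically closed) range of the isometry `V`; it is
invariant under `N`, and `V` carries `T` to the restriction of `N`, because `N V = V T`. -/
def IsSubnormal {H : Type u} [NormedAddCommGroup H] [InnerProductSpace ℂ H] [CompleteSpace H]
    (T : H →L[ℂ] H) : Prop :=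
  ∃ (K : Type u) (_ : NormedAddCommGroup K) (_ : InnerProductSpace ℂ K) (_ : CompleteSpace K)
    (V : H →ₗᵢ[ℂ] K) (N : K →L[ℂ] K),
    IsStarNormal N ∧ ∀ x : H, N (V x) = V (T x)

/-- The weighted shift with positive weights `α` is moment infinitely divisible if for every
real `t > 0` the shift with weights `α_n ^ t` is a (bounded) subnormal operator. -/
def IsMomentInfinitelyDivisible (α : ℕ → ℝ) : Prop :=
  ∀ t : ℝ, 0 < t → ∃ h : BddAbove (Set.range fun n => |α n ^ t|),
    IsSubnormal (weightedShift (fun n => α n ^ t) h)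

/-- The difference operator `(∇ φ)(n) = φ(n) - φ(n + 1)` on real sequences. -/
def nabla (φ : ℕ → ℝ) : ℕ → ℝ := fun n => φ n - φ (n + 1)

/-- A real sequence `ψ` is completely alternating if `(∇^k ψ)(n) ≤ 0` for all `k ≥ 1`, `n ≥ 0`. -/
def IsCompletelyAlternating (ψ : ℕ → ℝ) : Prop :=
  ∀ k : ℕ, 1 ≤ k → ∀ n : ℕ, (nabla^[k] ψ) n ≤ 0

/-- A sequence is log completely alternating if its terms are positive and the sequence of their
logarithms is completely alternating. -/
def IsLogCompletelyAlternating (a : ℕ → ℝ) : Prop :=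
  (∀ n, 0 < a n) ∧ IsCompletelyAlternating (fun n => Real.log (a n))

/-! Put `γ n = ∏ i < n, α i ^ 2`. By Berger and Hausdorff, a shift with weights in `(0, 1]` is
subnormal exactly when its moments are completely monotone (`isSubnormal_weightedShift`,
`IsSubnormal.isCompletelyMonotone_weightMoment`). Raising the weights to the power `t` raises `γ` to
the power `t`, so moment infinite divisibility says that every `γ ^ t`, `t > 0`, is completely
monotone.

By Schoenberg's correspondence (`isCompletelyMonotone_rpow_iff`) this means that `∇ log γ` is
completely monotone. Since `∇ log γ = -log α²`, order zero of this condition is `α n ≤ 1`, which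
contractivity supplies, and the higher orders say that `log α²` is completely alternating. The last
equivalence is `log α² = 2 log α`. -/

/-! ### Iterated differences -/

theorem nabla_iterate_succ (a : ℕ → ℝ) (k n : ℕ) :
    nabla^[k + 1] a n = nabla^[k] a n - nabla^[k] a (n + 1) := by
  rw [Function.iterate_succ_apply']; rfl

theorem nabla_iterate_shift (a : ℕ → ℝ) (k n : ℕ) :
    nabla^[k] (fun i => a (i + 1)) n = nabla^[k] a (n + 1) := by
  induction k generalizing n with
  | zero => rfl
  | succ k ih => rw [nabla_iterate_succ, nabla_iterate_succ, ih, ih]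

theorem nabla_iterate_add (a b : ℕ → ℝ) (k n : ℕ) :
    nabla^[k] (fun i => a i + b i) n = nabla^[k] a n + nabla^[k] b n := by
  induction k generalizing n with
  | zero => rfl
  | succ k ih => simp only [nabla_iterate_succ, ih]; ring

theorem nabla_iterate_const_mul (c : ℝ) (a : ℕ → ℝ) (k n : ℕ) :
    nabla^[k] (fun i => c * a i) n = c * nabla^[k] a n := by
  induction k generalizing n with
  | zero => rfl
  | succ k ih => simp only [nabla_iterate_succ, ih]; ring

theorem nabla_iterate_const (c : ℝ) {k : ℕ} (hk : 1 ≤ k) (n : ℕ) :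
    nabla^[k] (fun _ => c) n = 0 := by
  induction k, hk using Nat.le_induction generalizing n with
  | base => simp [nabla]
  | succ k _ ih => rw [nabla_iterate_succ, ih, ih, sub_self]

theorem tendsto_nabla_iterate {ι : Type*} {l : Filter ι} {a : ι → ℕ → ℝ} {b : ℕ → ℝ}
    (h : ∀ n, Filter.Tendsto (fun i => a i n) l (nhds (b n))) (k n : ℕ) :
    Filter.Tendsto (fun i => nabla^[k] (a i) n) l (nhds (nabla^[k] b n)) := by
  induction k generalizing n with
  | zero => exact h n
  | succ k ih => simp only [nabla_iterate_succ]; exact (ih n).sub (ih (n + 1))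

/-! ### Closure properties of monotone sequences, with a bound on the order -/

/-- The differences of `a` of order at most `K` are nonnegative. -/
def IsMonotoneUpTo (K : ℕ) (a : ℕ → ℝ) : Prop :=
  ∀ k ≤ K, ∀ n, 0 ≤ nabla^[k] a n

/-- All differences of `a` are nonnegative. -/
def IsCompletelyMonotone (a : ℕ → ℝ) : Prop :=
  ∀ k n, 0 ≤ nabla^[k] a n

namespace IsMonotoneUpTo

variable {K : ℕ} {a b : ℕ → ℝ}

theorem of_le {L : ℕ} (h : IsMonotoneUpTo K a) (hL : L ≤ K) : IsMonotoneUpTo L a :=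
  fun k hk => h k (hk.trans hL)

theorem shift (h : IsMonotoneUpTo K a) : IsMonotoneUpTo K (fun n => a (n + 1)) := by
  intro k hk n
  rw [nabla_iterate_shift]
  exact h k hk _

theorem succ_iff : IsMonotoneUpTo (K + 1) a ↔ (∀ n, 0 ≤ a n) ∧ IsMonotoneUpTo K (nabla a) := by
  refine ⟨fun h => ⟨h 0 (by omega), fun k hk n => ?_⟩, fun h k hk n => ?_⟩
  · simpa using h (k + 1) (by omega) n
  · cases k with
    | zero => exact h.1 n
    | succ k => simpa using h.2 k (by omega) n

theorem add (ha : IsMonotoneUpTo K a) (hb : IsMonotoneUpTo K b) :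
    IsMonotoneUpTo K (fun n => a n + b n) := by
  intro k hk n
  rw [nabla_iterate_add]
  exact add_nonneg (ha k hk n) (hb k hk n)

theorem const_mul {c : ℝ} (hc : 0 ≤ c) (ha : IsMonotoneUpTo K a) :
    IsMonotoneUpTo K (fun n => c * a n) := by
  intro k hk n
  rw [nabla_iterate_const_mul]
  exact mul_nonneg hc (ha k hk n)

/-- Leibniz rule: `∇(ab) = (∇a) b + (Sa) ∇b` with `S` the shift. Each term uses one order less,
hence the induction on `K`. -/
theorem mul (ha : IsMonotoneUpTo K a) (hb : IsMonotoneUpTo K b) :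
    IsMonotoneUpTo K (fun n => a n * b n) := by
  induction K generalizing a b with
  | zero =>
    intro k hk n
    obtain rfl : k = 0 := by omega
    exact mul_nonneg (ha 0 le_rfl n) (hb 0 le_rfl n)
  | succ K ih =>
    rw [succ_iff]
    refine ⟨fun n => mul_nonneg (ha 0 (by omega) n) (hb 0 (by omega) n), ?_⟩
    have h1 := ih (succ_iff.1 ha).2 (hb.of_le K.le_succ)
    have h2 := ih (ha.of_le K.le_succ).shift (succ_iff.1 hb).2
    convert h1.add h2 using 2
    simp only [nabla]
    ring

theorem pow_succ (ha : IsMonotoneUpTo K a) (i : ℕ) : IsMonotoneUpTo K (fun n => a n ^ (i + 1)) := by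
  induction i with
  | zero => simpa using ha
  | succ i ih => simpa only [_root_.pow_succ _ (i + 1)] using ih.mul ha

theorem finset_sum {ι : Type*} (s : Finset ι) {f : ι → ℕ → ℝ}
    (hf : ∀ i ∈ s, IsMonotoneUpTo K (f i)) : IsMonotoneUpTo K (fun n => ∑ i ∈ s, f i n) := by
  classical
  induction s using Finset.induction_on with
  | empty =>
    intro k _ n
    have := nabla_iterate_const_mul 0 (fun _ => 0) k n
    simp only [zero_mul] at this
    simp [this]
  | insert i s hi ih =>
    simp only [Finset.sum_insert hi]
    exact (hf i (by simp)).add (ih fun j hj => hf j (by simp [hj]))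

theorem of_tendsto {ι : Type*} {l : Filter ι} [l.NeBot] {f : ι → ℕ → ℝ}
    (hf : ∀ i, IsMonotoneUpTo K (f i))
    (h : ∀ n, Filter.Tendsto (fun i => f i n) l (nhds (a n))) : IsMonotoneUpTo K a :=
  fun k hk n => ge_of_tendsto' (tendsto_nabla_iterate h k n) fun i => hf i k hk n

/-- The exponential series without its constant term has nonnegative coefficients, and the cone is
closed under products and pointwise limits. -/
theorem exp_sub_one (ha : IsMonotoneUpTo K a) :
    IsMonotoneUpTo K (fun n => Real.exp (a n) - 1) := by
  refine of_tendsto (l := Filter.atTop)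
    (f := fun M n => ∑ i ∈ Finset.range M, ((i + 1).factorial : ℝ)⁻¹ * a n ^ (i + 1))
    (fun M => finset_sum _ fun i _ => (ha.pow_succ i).const_mul (by positivity)) fun n => ?_
  have h : HasSum (fun i : ℕ => (i.factorial : ℝ)⁻¹ * a n ^ i) (Real.exp (a n)) := by
    rw [Real.exp_eq_exp_ℝ]
    simpa using NormedSpace.exp_series_hasSum_exp' (𝕂 := ℝ) (a n)
  have h' := (hasSum_nat_add_iff' 1).2 h
  simpa using h'.tendsto_sum_nat

/-- If the negative of `g` is completely alternating, then `exp ∘ g` is completely monotone. -/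
theorem exp_of_nabla {g : ℕ → ℝ} (hg : ∀ K, IsMonotoneUpTo K (nabla g)) (K : ℕ) :
    IsMonotoneUpTo K (fun n => Real.exp (g n)) := by
  induction K with
  | zero =>
    intro k hk n
    obtain rfl : k = 0 := by omega
    exact (Real.exp_pos _).le
  | succ K ih =>
    refine succ_iff.2 ⟨fun n => (Real.exp_pos _).le, ?_⟩
    -- `∇ e^g (n) = e^{g(n+1)} (e^{∇g(n)} - 1)`, so order `K + 1` follows from order `K`.
    convert ih.shift.mul (hg K).exp_sub_one using 2 with n
    simp only [nabla]
    rw [mul_sub, ← Real.exp_add]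
    simp

end IsMonotoneUpTo

/-! ### Schoenberg's correspondence -/

/-- Schoenberg's correspondence between completely alternating and completely monotone sequences. -/
theorem isCompletelyMonotone_rpow_iff {γ : ℕ → ℝ} (hγ : ∀ n, 0 < γ n) :
    (∀ t : ℝ, 0 < t → IsCompletelyMonotone (fun n => γ n ^ t)) ↔
      IsCompletelyMonotone (nabla fun n => Real.log (γ n)) := by
  refine ⟨fun h k n => ?_, fun h t ht k n => ?_⟩
  -- `log γ` is the right derivative of `γ ^ t` at `t = 0`; differences of order at least one kill
  -- the constant `-1`.
  · have hlim : ∀ m, Filter.Tendsto (fun t : ℝ => t⁻¹ * (γ m ^ t + -1))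
        (nhdsWithin 0 (Set.Ioi 0)) (nhds (Real.log (γ m))) := by
      intro m
      have hd : HasDerivAt (fun t : ℝ => γ m ^ t) (Real.log (γ m)) 0 := by
        simpa using (Real.hasStrictDerivAt_const_rpow (hγ m) 0).hasDerivAt
      have := hd.hasDerivWithinAt (s := Set.Ioi 0)
      rw [hasDerivWithinAt_iff_tendsto_slope' (by simp)] at this
      refine this.congr fun t => ?_
      simp [slope_def_field, div_eq_inv_mul, sub_eq_add_neg]
    have := tendsto_nabla_iterate hlim (k + 1) n
    rw [← Function.iterate_succ_apply]
    refine ge_of_tendsto this ?_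
    filter_upwards [self_mem_nhdsWithin] with t ht
    rw [nabla_iterate_const_mul, nabla_iterate_add, nabla_iterate_const _ (by omega), add_zero]
    exact mul_nonneg (inv_nonneg.2 (le_of_lt ht)) (h t ht _ _)
  · have hg : ∀ K, IsMonotoneUpTo K (nabla fun n => t * Real.log (γ n)) := by
      intro K j _ m
      have := h j m
      rw [← Function.iterate_succ_apply] at this ⊢
      rw [nabla_iterate_const_mul]
      exact mul_nonneg ht.le this
    have := IsMonotoneUpTo.exp_of_nabla hg k k le_rfl n
    simpa only [Real.rpow_def_of_pos (hγ _), mul_comm] using this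

/-! ### Bernstein weights and the Hausdorff moment problem -/

/-- With `S` the shift and `∇ = 1 - S`, this is the binomial expansion of `(S + ∇)^N = 1`; the
induction uses Pascal's rule. -/
theorem sum_choose_mul_nabla (a : ℕ → ℝ) (N n : ℕ) :
    ∑ k ∈ Finset.range (N + 1), (N.choose k : ℝ) * nabla^[N - k] a (k + n) = a n := by
  induction N generalizing a n with
  | zero => simp
  | succ N ih =>
    have h1 := ih (nabla a) n
    have h2 := ih a (n + 1)
    rw [Finset.sum_range_succ']
    have h3 : ∀ k, ((N + 1).choose (k + 1) : ℝ) * nabla^[N + 1 - (k + 1)] a (k + 1 + n) =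
        (N.choose k : ℝ) * nabla^[N - k] a (k + (n + 1)) +
          (N.choose (k + 1) : ℝ) * nabla^[N - k] a (k + 1 + n) := by
      intro k
      rw [Nat.choose_succ_succ, Nat.add_sub_add_right, add_right_comm k 1 n, add_assoc k n 1]
      push_cast
      ring
    simp only [h3, Finset.sum_add_distrib, h2]
    have h4 : ∑ k ∈ Finset.range (N + 1), (N.choose (k + 1) : ℝ) * nabla^[N - k] a (k + 1 + n) +
        ((N + 1).choose 0 : ℝ) * nabla^[N + 1 - 0] a (0 + n) =
        ∑ k ∈ Finset.range (N + 1), (N.choose k : ℝ) * nabla^[N - k] (nabla a) (k + n) := by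
      rw [Finset.sum_range_succ, Finset.sum_range_succ' _ N]
      simp only [Nat.choose_succ_self, Nat.cast_zero, zero_mul, add_zero, Nat.choose_zero_right,
        ← Function.iterate_succ_apply, Nat.succ_eq_add_one, Nat.sub_zero]
      congr 1
      refine Finset.sum_congr rfl fun k hk => ?_
      rw [Finset.mem_range] at hk
      rw [show N - (k + 1) + 1 = N - k by omega]
    rw [add_assoc, h4, h1]
    simp [nabla]

/-- Absorbing falling factorials into binomials reduces to the previous identity for a shifted
sequence. Thus the Bernstein weights have exact factorial moments. -/
theorem sum_choose_mul_descFactorial_mul_nabla (a : ℕ → ℝ) (N m : ℕ) :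
    ∑ k ∈ Finset.range (N + 1), (N.choose k : ℝ) * nabla^[N - k] a k * k.descFactorial m =
      N.descFactorial m * a m := by
  induction m generalizing a N with
  | zero => simpa using sum_choose_mul_nabla a N 0
  | succ m ih =>
    cases N with
    | zero => simp
    | succ N =>
      rw [Finset.sum_range_succ']
      simp only [Nat.zero_descFactorial_succ, Nat.cast_zero, mul_zero, add_zero]
      have h := ih (fun i => a (i + 1)) N
      rw [Nat.succ_descFactorial_succ, Nat.cast_mul, mul_assoc, ← h, Finset.mul_sum]
      refine Finset.sum_congr rfl fun k _ => ?_
      have hc : ((N + 1).choose (k + 1) : ℝ) * (k + 1) = (N + 1) * N.choose k := by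
        exact_mod_cast (Nat.add_one_mul_choose_eq N k).symm
      rw [nabla_iterate_shift, Nat.succ_descFactorial_succ, Nat.add_sub_add_right]
      push_cast
      linear_combination nabla^[N - k] a (k + 1) * (k.descFactorial m : ℝ) * hc

theorem cast_descFactorial_succ (k m : ℕ) :
    (k.descFactorial (m + 1) : ℝ) = ((k : ℝ) - m) * k.descFactorial m := by
  rw [Nat.descFactorial_succ]
  rcases le_or_gt m k with h | h
  · push_cast [Nat.cast_sub h]; ring
  · simp [Nat.descFactorial_of_lt h]

/-- Powers and normalised falling factorials differ by `O(1 / N)` uniformly in `k`. Passing from `m`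
to `m + 1` adds at most `m / N` to the error, and `m² + m ≤ (m + 1)²`. -/
theorem descFactorial_div_pow_bounds {k N : ℕ} (hN : 0 < N) (hk : k ≤ N) (m : ℕ) :
    0 ≤ ((k : ℝ) / N) ^ m - k.descFactorial m / (N : ℝ) ^ m ∧
      ((k : ℝ) / N) ^ m - k.descFactorial m / (N : ℝ) ^ m ≤ (m : ℝ) ^ 2 / N := by
  have hN' : (0 : ℝ) < N := by exact_mod_cast hN
  have hx0 : (0 : ℝ) ≤ (k : ℝ) / N := by positivity
  have hx1 : (k : ℝ) / N ≤ 1 := (div_le_one hN').2 (by exact_mod_cast hk)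
  induction m with
  | zero => simp
  | succ m ih =>
    obtain ⟨h0, h1⟩ := ih
    set y : ℝ := k.descFactorial m / (N : ℝ) ^ m with hy
    set x : ℝ := (k : ℝ) / N with hx
    have hy0 : 0 ≤ y := by positivity
    have hy1 : y ≤ 1 := by
      have : x ^ m ≤ 1 := pow_le_one₀ hx0 hx1
      linarith
    have e : x ^ (m + 1) - (k.descFactorial (m + 1) : ℝ) / (N : ℝ) ^ (m + 1) =
        x * (x ^ m - y) + m / N * y := by
      have : (k.descFactorial (m + 1) : ℝ) / (N : ℝ) ^ (m + 1) = (x - m / N) * y := by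
        rw [cast_descFactorial_succ, hy, hx]
        field_simp
        ring
      rw [this]
      ring
    rw [e]
    have hm : (0 : ℝ) ≤ (m : ℝ) / N := by positivity
    refine ⟨by positivity, ?_⟩
    have a1 : x * (x ^ m - y) ≤ (m : ℝ) ^ 2 / N := (mul_le_of_le_one_left h0 hx1).trans h1
    have a2 : (m : ℝ) / N * y ≤ m / N := mul_le_of_le_one_right hm hy1
    have a3 : (m : ℝ) ^ 2 / N + m / N ≤ ((m + 1 : ℕ) : ℝ) ^ 2 / N := by
      rw [← add_div]
      gcongr
      push_cast
      nlinarith [(Nat.cast_nonneg m : (0 : ℝ) ≤ m)]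
    linarith

/-- The point `k / N` of the unit interval. -/
noncomputable def unitIntervalNode (N k : ℕ) : unitInterval :=
  Set.projIcc 0 1 zero_le_one ((k : ℝ) / N)

theorem coe_unitIntervalNode {N k : ℕ} (hk : k ≤ N) :
    (unitIntervalNode N k : ℝ) = (k : ℝ) / N := by
  rw [unitIntervalNode, Set.projIcc_of_mem]
  exact ⟨by positivity, div_le_one_of_le₀ (by exact_mod_cast hk) (by positivity)⟩

/-- The discrete measure on `[0, 1]` with the Bernstein weights of the sequence `a`. -/
noncomputable def bernsteinMeasure (a : ℕ → ℝ) (N : ℕ) : MeasureTheory.Measure unitInterval :=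
  ∑ k ∈ Finset.range (N + 1), ENNReal.ofReal ((N.choose k : ℝ) * nabla^[N - k] a k) •
    MeasureTheory.Measure.dirac (unitIntervalNode N k)

theorem integral_bernsteinMeasure {a : ℕ → ℝ} (ha : IsCompletelyMonotone a) (N : ℕ)
    (f : C(unitInterval, ℝ)) :
    ∫ x, f x ∂(bernsteinMeasure a N) = ∑ k ∈ Finset.range (N + 1),
      (N.choose k : ℝ) * nabla^[N - k] a k * f (unitIntervalNode N k) := by
  rw [bernsteinMeasure, MeasureTheory.integral_finsetSum_measure]
  · refine Finset.sum_congr rfl fun k _ => ?_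
    rw [MeasureTheory.integral_smul_measure, MeasureTheory.integral_dirac,
      ENNReal.toReal_ofReal (mul_nonneg (by positivity) (ha _ _)), smul_eq_mul]
  · intro k _
    exact (MeasureTheory.integrable_dirac (by simp)).smul_measure ENNReal.ofReal_ne_top

theorem isProbabilityMeasure_bernsteinMeasure {a : ℕ → ℝ} (ha : IsCompletelyMonotone a)
    (h0 : a 0 = 1) (N : ℕ) : MeasureTheory.IsProbabilityMeasure (bernsteinMeasure a N) := by
  constructor
  have := sum_choose_mul_nabla a N 0
  simp only [add_zero] at this
  simp only [bernsteinMeasure, MeasureTheory.Measure.coe_finsetSum, Finset.sum_apply,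
    MeasureTheory.Measure.smul_apply, MeasureTheory.measure_univ, smul_eq_mul, mul_one]
  rw [← ENNReal.ofReal_sum_of_nonneg fun k _ => mul_nonneg (by positivity) (ha _ _), this, h0,
    ENNReal.ofReal_one]

theorem abs_moment_bernsteinMeasure_sub_le {a : ℕ → ℝ} (ha : IsCompletelyMonotone a)
    (h0 : a 0 = 1) {N : ℕ} (hN : 0 < N) (m : ℕ) :
    |∫ x, (x : ℝ) ^ m ∂(bernsteinMeasure a N) - a m| ≤ (m : ℝ) ^ 2 / N := by
  have hN' : (0 : ℝ) < N := by exact_mod_cast hN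
  have hI := integral_bernsteinMeasure ha N
    ⟨fun x : unitInterval => (x : ℝ) ^ m, by fun_prop⟩
  simp only [ContinuousMap.coe_mk] at hI
  have hw : ∀ k, 0 ≤ (N.choose k : ℝ) * nabla^[N - k] a k :=
    fun k => mul_nonneg (by positivity) (ha _ _)
  have hw1 : ∑ k ∈ Finset.range (N + 1), (N.choose k : ℝ) * nabla^[N - k] a k = 1 := by
    simpa [h0] using sum_choose_mul_nabla a N 0
  have hD : ∫ x, (x : ℝ) ^ m ∂(bernsteinMeasure a N) - N.descFactorial m / (N : ℝ) ^ m * a m =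
      ∑ k ∈ Finset.range (N + 1), (N.choose k : ℝ) * nabla^[N - k] a k *
        (((k : ℝ) / N) ^ m - k.descFactorial m / (N : ℝ) ^ m) := by
    simp only [mul_sub, Finset.sum_sub_distrib]
    rw [hI]
    congr 1
    · refine Finset.sum_congr rfl fun k hk => ?_
      rw [coe_unitIntervalNode (by simpa [Nat.lt_succ_iff] using hk)]
    · rw [div_mul_eq_mul_div, ← sum_choose_mul_descFactorial_mul_nabla, Finset.sum_div]
      exact Finset.sum_congr rfl fun k _ => (mul_div_assoc _ _ _)
  have hDnn : 0 ≤ ∑ k ∈ Finset.range (N + 1), (N.choose k : ℝ) * nabla^[N - k] a k *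
        (((k : ℝ) / N) ^ m - k.descFactorial m / (N : ℝ) ^ m) :=
    Finset.sum_nonneg fun k hk => mul_nonneg (hw k) (descFactorial_div_pow_bounds hN
      (by simpa [Nat.lt_succ_iff] using hk) m).1
  have hDle : ∑ k ∈ Finset.range (N + 1), (N.choose k : ℝ) * nabla^[N - k] a k *
        (((k : ℝ) / N) ^ m - k.descFactorial m / (N : ℝ) ^ m) ≤ (m : ℝ) ^ 2 / N := by
    rw [← one_mul ((m : ℝ) ^ 2 / N), ← hw1, Finset.sum_mul]
    exact Finset.sum_le_sum fun k hk => mul_le_mul_of_nonneg_left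
      (descFactorial_div_pow_bounds hN (by simpa [Nat.lt_succ_iff] using hk) m).2 (hw k)
  obtain ⟨b0, b1⟩ := descFactorial_div_pow_bounds hN le_rfl m
  rw [div_self hN'.ne', one_pow] at b0 b1
  have am0 : 0 ≤ a m := ha 0 m
  have am1 : a m ≤ 1 := by
    rw [← h0]
    refine antitone_nat_of_succ_le (fun n => ?_) (Nat.zero_le m)
    have := ha 1 n
    simpa [nabla] using this
  have c0 := mul_nonneg b0 am0
  have c1 : (1 - (N.descFactorial m : ℝ) / (N : ℝ) ^ m) * a m ≤ (m : ℝ) ^ 2 / N :=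
    (mul_le_of_le_one_right b0 am1).trans b1
  -- The error is a difference of two quantities in `[0, m² / N]`, so the bound is not doubled.
  rw [abs_le]
  constructor <;> linarith

/-- The Hausdorff moment theorem. -/
theorem IsCompletelyMonotone.exists_moment_measure {a : ℕ → ℝ} (ha : IsCompletelyMonotone a)
    (h0 : a 0 = 1) : ∃ μ : MeasureTheory.Measure unitInterval,
      MeasureTheory.IsProbabilityMeasure μ ∧ ∀ m : ℕ, ∫ x, (x : ℝ) ^ m ∂μ = a m := by
  let P : ℕ → MeasureTheory.ProbabilityMeasure unitInterval := fun N =>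
    ⟨bernsteinMeasure a N, isProbabilityMeasure_bernsteinMeasure ha h0 N⟩
  -- Probability measures on `[0, 1]` are weakly compact; a limit along an ultrafilter replaces a
  -- convergent subsequence.
  obtain ⟨μ, -, hμ⟩ := (isCompact_univ (X := MeasureTheory.ProbabilityMeasure unitInterval)).ultrafilter_le_nhds'
    ((Filter.hyperfilter ℕ).map P) (Filter.univ_mem)
  refine ⟨μ, inferInstance, fun m => ?_⟩
  have hP : Filter.Tendsto P (Filter.hyperfilter ℕ) (nhds μ) := hμ
  rw [MeasureTheory.ProbabilityMeasure.tendsto_iff_forall_integral_tendsto] at hP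
  have h1 := hP (BoundedContinuousFunction.mkOfCompact
    ⟨fun x : unitInterval => (x : ℝ) ^ m, by fun_prop⟩)
  simp only [BoundedContinuousFunction.mkOfCompact_apply, ContinuousMap.coe_mk] at h1
  refine tendsto_nhds_unique h1 (Filter.Tendsto.mono_left ?_ Nat.hyperfilter_le_atTop)
  rw [tendsto_iff_dist_tendsto_zero]
  refine squeeze_zero' (.of_forall fun _ => dist_nonneg) ?_
    (tendsto_const_div_atTop_nhds_zero_nat ((m : ℝ) ^ 2))
  filter_upwards [Filter.eventually_gt_atTop 0] with N hN
  exact abs_moment_bernsteinMeasure_sub_le ha h0 hN m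

/-! ### Multiplication operators on `L²` -/

section MulOperator

open MeasureTheory

variable {X : Type u} [TopologicalSpace X] [CompactSpace X] [MeasurableSpace X] [BorelSpace X]
  (μ : Measure X) [IsFiniteMeasure μ]

/-- Multiplication by a continuous function on `L²`. -/
noncomputable def mulOperator (φ : C(X, ℂ)) : Lp ℂ 2 μ →L[ℂ] Lp ℂ 2 μ :=
  (ContinuousLinearMap.mul ℂ ℂ).holderL μ ∞ 2 2 (ContinuousMap.toLp ∞ μ ℂ φ)

theorem coeFn_mulOperator (φ : C(X, ℂ)) (f : Lp ℂ 2 μ) :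
    mulOperator μ φ f =ᵐ[μ] fun x => φ x * f x := by
  have h1 := (ContinuousLinearMap.mul ℂ ℂ).coeFn_holder (r := 2)
    (ContinuousMap.toLp ∞ μ ℂ φ) f
  have h2 := ContinuousMap.coeFn_toLp (p := ∞) (𝕜 := ℂ) μ φ
  filter_upwards [h1, h2] with x hx1 hx2
  rw [← hx2]
  exact hx1

theorem mulOperator_mul (φ ψ : C(X, ℂ)) :
    mulOperator μ (φ * ψ) = mulOperator μ φ * mulOperator μ ψ := by
  ext1 f
  refine Lp.ext ?_
  filter_upwards [coeFn_mulOperator μ (φ * ψ) f, coeFn_mulOperator μ φ (mulOperator μ ψ f),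
    coeFn_mulOperator μ ψ f] with x h1 h2 h3
  rw [h1, mul_apply_eq_comp, h2, h3, ContinuousMap.mul_apply, mul_assoc]

theorem star_mulOperator (φ : C(X, ℂ)) : star (mulOperator μ φ) = mulOperator μ (star φ) := by
  rw [ContinuousLinearMap.star_eq_adjoint]
  symm
  rw [ContinuousLinearMap.eq_adjoint_iff]
  intro f g
  rw [L2.inner_def, L2.inner_def]
  refine integral_congr_ae ?_
  filter_upwards [coeFn_mulOperator μ (star φ) f, coeFn_mulOperator μ φ g] with x h1 h2
  rw [h1, h2]
  simp only [RCLike.inner_apply, ContinuousMap.star_apply, map_mul, RCLike.star_def,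
    RCLike.conj_conj]
  ring

theorem isStarNormal_mulOperator (φ : C(X, ℂ)) : IsStarNormal (mulOperator μ φ) := by
  constructor
  rw [star_mulOperator, commute_iff_eq, ← mulOperator_mul, ← mulOperator_mul, mul_comm]

theorem mulOperator_toLp (φ ψ : C(X, ℂ)) :
    mulOperator μ φ (ContinuousMap.toLp 2 μ ℂ ψ) = ContinuousMap.toLp 2 μ ℂ (φ * ψ) := by
  refine Lp.ext ?_
  filter_upwards [coeFn_mulOperator μ φ (ContinuousMap.toLp 2 μ ℂ ψ),
    ContinuousMap.coeFn_toLp (p := 2) (𝕜 := ℂ) μ ψ,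
    ContinuousMap.coeFn_toLp (p := 2) (𝕜 := ℂ) μ (φ * ψ)] with x h1 h2 h3
  rw [h1, h2, h3, ContinuousMap.mul_apply]

end MulOperator

/-! ### From a moment measure to a normal extension -/

/-- The isometry sends the standard basis to `v`; by continuity the intertwining relation need only
be checked on basis vectors. -/
theorem isSubnormal_weightedShift_of_orthonormal {K : Type} [NormedAddCommGroup K]
    [InnerProductSpace ℂ K] [CompleteSpace K] {N : K →L[ℂ] K} (hN : IsStarNormal N)
    {v : ℕ → K} (hv : Orthonormal ℂ v) {β : ℕ → ℝ} (hβ : BddAbove (Set.range fun n => |β n|))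
    (hNv : ∀ n, N (v n) = (β n : ℂ) • v (n + 1)) : IsSubnormal (weightedShift β hβ) := by
  refine ⟨K, inferInstance, inferInstance, inferInstance, hv.orthogonalFamily.linearIsometry, N,
    hN, fun x => ?_⟩
  have key : N ∘L hv.orthogonalFamily.linearIsometry.toContinuousLinearMap =
      hv.orthogonalFamily.linearIsometry.toContinuousLinearMap ∘L weightedShift β hβ := by
    refine lp.ext_continuousLinearMap ENNReal.ofNat_ne_top fun j => ?_
    ext
    change N (hv.orthogonalFamily.linearIsometry (lp.single 2 j (1 : ℂ))) =
      hv.orthogonalFamily.linearIsometry (weightedShift β hβ (lp.single 2 j (1 : ℂ)))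
    rw [weightedShift_single, map_smul, OrthogonalFamily.linearIsometry_apply_single,
      OrthogonalFamily.linearIsometry_apply_single]
    simpa using hNv j
  exact DFunLike.congr_fun key x

/-- The moments of a weight sequence: `γ₀ = 1` and `γ_{n+1} = β_n² γ_n`. -/
noncomputable def weightMoment (β : ℕ → ℝ) (n : ℕ) : ℝ := ∏ i ∈ Finset.range n, β i ^ 2

theorem weightMoment_succ (β : ℕ → ℝ) (n : ℕ) :
    weightMoment β (n + 1) = weightMoment β n * β n ^ 2 := Finset.prod_range_succ _ _

theorem weightMoment_pos {β : ℕ → ℝ} (hβ : ∀ n, 0 < β n) (n : ℕ) : 0 < weightMoment β n :=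
  Finset.prod_pos fun i _ => pow_pos (hβ i) 2

instance fact_two_pi_pos : Fact (0 < 2 * Real.pi) := ⟨Real.two_pi_pos⟩

/-- The polar form `(r, θ) ↦ √r e^{iθ}` of the complex coordinate, `r` being the squared modulus. -/
noncomputable def polarCoordinate : C(unitInterval × AddCircle (2 * Real.pi), ℂ) where
  toFun p := (Real.sqrt p.1 : ℂ) * fourier 1 p.2
  continuous_toFun := by fun_prop

theorem polarCoordinate_pow_apply (n : ℕ) (p : unitInterval × AddCircle (2 * Real.pi)) :
    (polarCoordinate ^ n) p = ((Real.sqrt p.1 ^ n : ℝ) : ℂ) * fourier n p.2 := by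
  induction n with
  | zero => simp
  | succ n ih =>
    rw [pow_succ, ContinuousMap.mul_apply, ih, polarCoordinate]
    push_cast
    rw [fourier_add]
    simp only [ContinuousMap.coe_mk]
    ring

open MeasureTheory in
-- The integral factors: orthogonality of characters handles the angle, and `√r ^ (2n) = r ^ n` the
-- radius.
theorem inner_polarCoordinate_pow (μ : Measure unitInterval) [IsProbabilityMeasure μ] (m n : ℕ) :
    inner ℂ (ContinuousMap.toLp 2 (μ.prod AddCircle.haarAddCircle) ℂ (polarCoordinate ^ m))
      (ContinuousMap.toLp 2 (μ.prod AddCircle.haarAddCircle) ℂ (polarCoordinate ^ n)) =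
      if m = n then ((∫ x, (x : ℝ) ^ n ∂μ : ℝ) : ℂ) else 0 := by
  rw [ContinuousMap.inner_toLp]
  have h1 : ∀ p : unitInterval × AddCircle (2 * Real.pi),
      (polarCoordinate ^ n) p * (starRingEnd ℂ) ((polarCoordinate ^ m) p) =
      ((Real.sqrt p.1 ^ (n + m) : ℝ) : ℂ) *
        (fourier (n : ℤ) p.2 * (starRingEnd ℂ) (fourier (m : ℤ) p.2)) := by
    intro p
    rw [polarCoordinate_pow_apply, polarCoordinate_pow_apply, map_mul, Complex.conj_ofReal,
      pow_add]
    push_cast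
    ring
  simp only [h1]
  rw [integral_prod_mul (fun x : unitInterval => ((Real.sqrt x ^ (n + m) : ℝ) : ℂ))
    (fun θ : AddCircle (2 * Real.pi) =>
      fourier (n : ℤ) θ * (starRingEnd ℂ) (fourier (m : ℤ) θ))]
  have h2 := orthonormal_iff_ite.1 (orthonormal_fourier (T := 2 * Real.pi)) m n
  rw [fourierLp, fourierLp, ContinuousMap.inner_toLp] at h2
  rw [h2, integral_complex_ofReal]
  by_cases h : m = n
  · subst h
    have h3 : ∀ x : unitInterval, Real.sqrt (x : ℝ) ^ (m + m) = (x : ℝ) ^ m := fun x => by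
      rw [← two_mul, pow_mul, Real.sq_sqrt x.2.1]
    simp [h3]
  · simp [h]

/-- One half of Berger's theorem, for contractive shifts. -/
theorem isSubnormal_weightedShift {β : ℕ → ℝ} (hpos : ∀ n, 0 < β n)
    (hβ : BddAbove (Set.range fun n => |β n|)) (h : IsCompletelyMonotone (weightMoment β)) :
    IsSubnormal (weightedShift β hβ) := by
  obtain ⟨μ, hμ, hm⟩ := h.exists_moment_measure (by simp [weightMoment])
  have hγ := weightMoment_pos hpos
  let ν := μ.prod (AddCircle.haarAddCircle (T := 2 * Real.pi))
  -- Normalised monomials `z^n / √γ n`; as `γ (n + 1) = γ n * β n ^ 2`, multiplication by `z` shifts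
  -- them with weights `β`.
  let v : ℕ → MeasureTheory.Lp ℂ 2 ν := fun n =>
    ((Real.sqrt (weightMoment β n))⁻¹ : ℂ) • ContinuousMap.toLp 2 ν ℂ (polarCoordinate ^ n)
  have hs : ∀ n, (Real.sqrt (weightMoment β n) : ℂ) ≠ 0 := fun n =>
    Complex.ofReal_ne_zero.2 (Real.sqrt_pos.2 (hγ n)).ne'
  refine isSubnormal_weightedShift_of_orthonormal (isStarNormal_mulOperator ν polarCoordinate)
    (v := v) ?_ hβ fun n => ?_
  · rw [orthonormal_iff_ite]
    intro i j
    simp only [v, inner_smul_left, inner_smul_right]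
    rw [inner_polarCoordinate_pow, hm]
    split_ifs with hij
    · subst hij
      have h4 : (weightMoment β i : ℂ) =
          (Real.sqrt (weightMoment β i) : ℂ) * Real.sqrt (weightMoment β i) := by
        rw [← Complex.ofReal_mul, Real.mul_self_sqrt (hγ i).le]
      have := hs i
      rw [map_inv₀, Complex.conj_ofReal]
      rw [h4]
      field_simp
    · simp
  · simp only [v, map_smul, mulOperator_toLp, smul_smul, ← pow_succ']
    congr 1
    rw [weightMoment_succ, Real.sqrt_mul (hγ n).le, Real.sqrt_sq (hpos n).le]
    have := hs n
    have : (β n : ℂ) ≠ 0 := Complex.ofReal_ne_zero.2 (hpos n).ne'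
    push_cast
    field_simp

/-! ### From a normal extension to completely monotone moments -/

theorem nabla_iterate_pow {A : Type*} [Ring A] (L : A →+ ℝ) (T : A) (k n : ℕ) :
    nabla^[k] (fun i => L (T ^ i)) n = L (T ^ n * (1 - T) ^ k) := by
  induction k generalizing n with
  | zero => simp
  | succ k ih =>
    rw [nabla_iterate_succ, ih, ih, ← map_sub]
    congr 1
    rw [pow_succ T n, pow_succ' (1 - T) k]
    noncomm_ring

/-- The quadratic form `T ↦ re ⟪T v, v⟫` of a vector, as an additive map on operators. -/
noncomputable def vectorState {K : Type u} [NormedAddCommGroup K] [InnerProductSpace ℂ K]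
    (v : K) : (K →L[ℂ] K) →+ ℝ where
  toFun T := (inner ℂ (T v) v).re
  map_zero' := by simp
  map_add' S T := by simp

section

variable {K : Type u} [NormedAddCommGroup K] [InnerProductSpace ℂ K]

theorem vectorState_mono (v : K) {S T : K →L[ℂ] K} (h : S ≤ T) :
    vectorState v S ≤ vectorState v T := by
  rw [← sub_nonneg, ← map_sub]
  exact ((ContinuousLinearMap.le_def _ _).1 h).re_inner_nonneg_left v

theorem vectorState_smul (v : K) (c : ℝ) (T : K →L[ℂ] K) :
    vectorState v (c • T) = c * vectorState v T := by
  change (inner ℂ ((c • T) v) v).re = c * (inner ℂ (T v) v).re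
  rw [smul_apply, ← Complex.coe_smul, inner_smul_left]
  simp

variable [CompleteSpace K]

/-- A positive operator with bounded moments at `v` has completely monotone moments at `v`. -/
theorem isCompletelyMonotone_vectorState_pow {A : K →L[ℂ] K} (hA : 0 ≤ A) (v : K) {C : ℝ}
    (hC : ∀ n : ℕ, vectorState v (A ^ n) ≤ C) :
    IsCompletelyMonotone (fun n => vectorState v (A ^ n)) := by
  have hsa : IsSelfAdjoint A := IsSelfAdjoint.of_nonneg hA
  have hspec : ∀ x ∈ spectrum ℝ A, 0 ≤ x := fun x hx => spectrum_nonneg_of_nonneg hA hx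
  set p : ℝ → ℝ := fun x => max (x - 1) 0 with hp
  have hpc : Continuous p := by fun_prop
  -- In spectral terms, `v` has no mass on `(1, ∞)`: Bernoulli gives `n * p x ≤ x ^ n` on the
  -- spectrum, while the moments stay bounded.
  have hp0 : vectorState v (cfc p A) ≤ 0 := by
    have hle : ∀ n : ℕ, (n : ℝ) * vectorState v (cfc p A) ≤ C := by
      intro n
      refine le_trans ?_ (hC n)
      rw [← vectorState_smul, ← cfc_const_mul (n : ℝ) p A hpc.continuousOn,
        ← cfc_pow_id (R := ℝ) A n]
      refine vectorState_mono v (cfc_mono (fun x hx => ?_))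
      have hx0 := hspec x hx
      simp only [hp]
      rcases le_total x 1 with h | h
      · rw [max_eq_right (by linarith), mul_zero]; positivity
      · rw [max_eq_left (by linarith)]
        have := one_add_mul_le_pow (show -2 ≤ x - 1 by linarith) n
        rw [add_sub_cancel] at this
        linarith
    by_contra! hneg
    obtain ⟨n, hn⟩ := exists_nat_gt (C / vectorState v (cfc p A))
    rw [div_lt_iff₀ hneg] at hn
    linarith [hle n]
  intro k n
  rw [nabla_iterate_pow]
  have hcfc : A ^ n * (1 - A) ^ k = cfc (fun x : ℝ => x ^ n * (1 - x) ^ k) A := by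
    rw [cfc_mul (fun x : ℝ => x ^ n) (fun x : ℝ => (1 - x) ^ k) A,
      cfc_pow (fun x : ℝ => 1 - x) k A, cfc_pow_id (R := ℝ) A n,
      cfc_sub (fun _ : ℝ => 1) (fun x => x) A, cfc_const_one ℝ A, cfc_id' ℝ A]
  rw [hcfc]
  rcases k.eq_zero_or_pos with rfl | hk
  · have : (0 : K →L[ℂ] K) ≤ cfc (fun x : ℝ => x ^ n * (1 - x) ^ 0) A :=
      cfc_nonneg fun x hx => by have := hspec x hx; positivity
    simpa using vectorState_mono v this
  · obtain ⟨M, hM⟩ : ∃ M : ℝ, ∀ x ∈ spectrum ℝ A, x ^ n * |1 - x| ^ (k - 1) ≤ M := by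
      obtain ⟨M, hM⟩ := (spectrum.isCompact (𝕜 := ℝ) A).bddAbove_image
        (f := fun x => x ^ n * |1 - x| ^ (k - 1)) (by fun_prop)
      exact ⟨M, fun x hx => hM ⟨x, hx, rfl⟩⟩
    -- On `[0, 1]` the right-hand function is nonnegative. Beyond `1`, one factor `|1 - x|` is `p x`
    -- and `M` bounds the rest. The maximum with `0` fixes the sign needed at the end.
    have hle : cfc (fun x => -max M 0 * p x) A ≤ cfc (fun x : ℝ => x ^ n * (1 - x) ^ k) A := by
      refine cfc_mono fun x hx => ?_
      have hx0 := hspec x hx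
      rcases le_total x 1 with h | h
      · have : p x = 0 := max_eq_right (by linarith)
        rw [this, mul_zero]
        exact mul_nonneg (pow_nonneg hx0 n) (pow_nonneg (by linarith) k)
      · have hpx : p x = x - 1 := max_eq_left (by linarith)
        have h1 : |1 - x| = x - 1 := by rw [abs_of_nonpos (by linarith)]; ring
        have h2 : -(x ^ n * |1 - x| ^ k) ≤ x ^ n * (1 - x) ^ k := by
          rw [← abs_pow, ← mul_neg]
          exact mul_le_mul_of_nonneg_left (neg_abs_le _) (pow_nonneg hx0 n)
        refine le_trans ?_ h2
        obtain ⟨j, rfl⟩ : ∃ j, k = j + 1 := ⟨k - 1, by omega⟩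
        have h3 := (hM x hx).trans (le_max_left M 0)
        rw [Nat.add_sub_cancel] at h3
        have h4 := mul_le_mul_of_nonneg_right h3 (show 0 ≤ x - 1 by linarith)
        rw [hpx, pow_succ, ← mul_assoc, neg_mul, neg_le_neg_iff]
        nth_rewrite 2 [h1]
        exact h4
    have h5 := vectorState_mono v hle
    rw [cfc_const_mul _ p A hpc.continuousOn, vectorState_smul] at h5
    refine le_trans ?_ h5
    exact mul_nonneg_of_nonpos_of_nonpos (by simp) hp0

/-- Normality gives `(N* N)^n = (N^n)* N^n`. -/
theorem vectorState_star_mul_self_pow {N : K →L[ℂ] K} (hN : IsStarNormal N) (v : K) (n : ℕ) :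
    vectorState v ((star N * N) ^ n) = ‖(N ^ n) v‖ ^ 2 := by
  rw [hN.star_comm_self.mul_pow, ← star_pow]
  change (inner ℂ ((star (N ^ n)) ((N ^ n) v)) v).re = _
  rw [ContinuousLinearMap.star_eq_adjoint, ContinuousLinearMap.adjoint_inner_left]
  exact (norm_sq_eq_re_inner (𝕜 := ℂ) _).symm

end

theorem weightedShift_pow_single_zero (β : ℕ → ℝ) (hβ : BddAbove (Set.range fun n => |β n|))
    (n : ℕ) : (weightedShift β hβ ^ n) (lp.single 2 0 (1 : ℂ)) =
      ((∏ i ∈ Finset.range n, β i : ℝ) : ℂ) • lp.single 2 n (1 : ℂ) := by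
  induction n with
  | zero => simp
  | succ n ih =>
    rw [pow_succ', mul_apply_eq_comp, ih, map_smul, weightedShift_single, smul_smul,
      Finset.prod_range_succ, Complex.ofReal_mul]

/-- The other half of Berger's theorem, for contractive shifts. -/
theorem IsSubnormal.isCompletelyMonotone_weightMoment {β : ℕ → ℝ}
    {hβ : BddAbove (Set.range fun n => |β n|)} (h : IsSubnormal (weightedShift β hβ))
    (h1 : ∀ n, |β n| ≤ 1) : IsCompletelyMonotone (weightMoment β) := by
  obtain ⟨K, _, _, _, V, N, hN, hNV⟩ := h
  set e : EllTwo := lp.single 2 0 (1 : ℂ) with he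
  have hpow : ∀ n, (N ^ n) (V e) = V ((weightedShift β hβ ^ n) e) := by
    intro n
    induction n with
    | zero => simp
    | succ n ih => rw [pow_succ', pow_succ', mul_apply_eq_comp, ih, hNV]; rfl
  have hγ : ∀ n, vectorState (V e) ((star N * N) ^ n) = weightMoment β n := by
    intro n
    rw [vectorState_star_mul_self_pow hN, hpow, V.norm_map, he, weightedShift_pow_single_zero,
      norm_smul, lp.norm_single (by norm_num), weightMoment, Finset.prod_pow, norm_one, mul_one,
      Complex.norm_real, Real.norm_eq_abs, sq_abs]
  have hle : ∀ n, weightMoment β n ≤ 1 := fun n =>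
    Finset.prod_le_one (fun i _ => sq_nonneg _) fun i _ => (sq_le_one_iff_abs_le_one _).2 (h1 i)
  -- `N` is not assumed contractive; bounded moments at the single vector `V e` suffice.
  have := isCompletelyMonotone_vectorState_pow (star_mul_self_nonneg N) (V e) (C := 1)
    fun n => (hγ n).trans_le (hle n)
  simpa only [hγ] using this

/-! ### Translation to the weights -/

theorem weight_le_norm_weightedShift (β : ℕ → ℝ) (hβ : BddAbove (Set.range fun n => |β n|))
    (n : ℕ) : |β n| ≤ ‖weightedShift β hβ‖ := by
  have := (weightedShift β hβ).le_opNorm (lp.single 2 n (1 : ℂ))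
  rwa [weightedShift_single, norm_smul, lp.norm_single (by norm_num), lp.norm_single (by norm_num),
    norm_one, mul_one, mul_one, Complex.norm_real, Real.norm_eq_abs] at this

theorem weightMoment_rpow {α : ℕ → ℝ} (hpos : ∀ n, 0 < α n) (t : ℝ) :
    weightMoment (fun n => α n ^ t) = fun n => weightMoment α n ^ t := by
  funext n
  rw [weightMoment, weightMoment, ← Real.finsetProd_rpow _ _ fun i _ => sq_nonneg _]
  refine Finset.prod_congr rfl fun i _ => ?_
  rw [← Real.rpow_natCast, ← Real.rpow_natCast, ← Real.rpow_mul (hpos i).le,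
    ← Real.rpow_mul (hpos i).le, mul_comm]

theorem isMomentInfinitelyDivisible_iff {α : ℕ → ℝ} (hpos : ∀ n, 0 < α n)
    (hle : ∀ n, α n ≤ 1) : IsMomentInfinitelyDivisible α ↔
      ∀ t : ℝ, 0 < t → IsCompletelyMonotone (fun n => weightMoment α n ^ t) := by
  have hle' : ∀ t : ℝ, 0 < t → ∀ n, |α n ^ t| ≤ 1 := fun t ht n => by
    rw [abs_of_pos (Real.rpow_pos_of_pos (hpos n) t)]
    exact Real.rpow_le_one (hpos n).le (hle n) ht.le
  refine forall₂_congr fun t ht => ?_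
  rw [← weightMoment_rpow hpos]
  refine ⟨fun ⟨_, h⟩ => h.isCompletelyMonotone_weightMoment (hle' t ht), fun h => ?_⟩
  have hb : BddAbove (Set.range fun n => |α n ^ t|) := ⟨1, by
    rintro _ ⟨n, rfl⟩
    exact hle' t ht n⟩
  exact ⟨hb, isSubnormal_weightedShift (fun n => Real.rpow_pos_of_pos (hpos n) t) hb h⟩

theorem isCompletelyMonotone_nabla_log_weightMoment_iff {α : ℕ → ℝ} (hpos : ∀ n, 0 < α n)
    (hle : ∀ n, α n ≤ 1) : IsCompletelyMonotone (nabla fun n => Real.log (weightMoment α n)) ↔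
      IsLogCompletelyAlternating (fun n => α n ^ 2) := by
  have hn : (nabla fun n => Real.log (weightMoment α n)) = fun n => -1 * Real.log (α n ^ 2) := by
    funext n
    rw [nabla, weightMoment_succ,
      Real.log_mul (weightMoment_pos hpos n).ne' (pow_pos (hpos n) 2).ne']
    ring
  rw [hn]
  have hneg : ∀ x : ℝ, 0 ≤ -1 * x ↔ x ≤ 0 := fun x => by rw [neg_one_mul, neg_nonneg]
  simp only [IsCompletelyMonotone, nabla_iterate_const_mul, hneg]
  refine ⟨fun h => ⟨fun n => pow_pos (hpos n) 2, fun k _ => h k⟩, fun h k n => ?_⟩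
  -- Complete alternation says nothing at order zero; that case is `α n ≤ 1`.
  rcases k.eq_zero_or_pos with rfl | hk
  · exact Real.log_nonpos (sq_nonneg _) (pow_le_one₀ (hpos n).le (hle n))
  · exact h.2 k hk n

theorem isLogCompletelyAlternating_sq_iff {α : ℕ → ℝ} (hpos : ∀ n, 0 < α n) :
    IsLogCompletelyAlternating (fun n => α n ^ 2) ↔ IsLogCompletelyAlternating α := by
  have hpos' : ∀ n, 0 < α n ^ 2 := fun n => pow_pos (hpos n) 2
  simp only [IsLogCompletelyAlternating, hpos, hpos', implies_true, true_and,
    IsCompletelyAlternating, Real.log_pow, nabla_iterate_const_mul]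
  refine forall₃_congr fun k _ n => ?_
  constructor <;> intro h <;> push_cast at * <;> linarith

theorem theorem3p1 (α : ℕ → ℝ) (hpos : ∀ n, 0 < α n)
    (hbdd : BddAbove (Set.range fun n => |α n|))
    (hcontr : ‖weightedShift α hbdd‖ ≤ 1) :
    (IsMomentInfinitelyDivisible α ↔ IsLogCompletelyAlternating (fun n => α n ^ 2)) ∧
      (IsLogCompletelyAlternating (fun n => α n ^ 2) ↔ IsLogCompletelyAlternating α) := by
  have hle : ∀ n, α n ≤ 1 := fun n =>
    (le_abs_self _).trans ((weight_le_norm_weightedShift α hbdd n).trans hcontr)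
  refine ⟨?_, isLogCompletelyAlternating_sq_iff hpos⟩
  rw [isMomentInfinitelyDivisible_iff hpos hle,
    isCompletelyMonotone_rpow_iff (weightMoment_pos hpos),
    isCompletelyMonotone_nabla_log_weightMoment_iff hpos hle]
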